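/- Let $K$ be an algebraically closed field of characteristic zero, and let $S^1$, $S_1$ be three-dimensional $K$-vector spaces equipped with a perfect pairing $a : S^1\times S_1\to K$. Write $S^\bullet$, $S_\bullet$ for their symmetric algebras and $S_4$ for the degree-four component of $S_\bullet$. Let $S^\bullet$ act on $S_\bullet$ by contraction (apolarity), $(s,f)\mapsto s\,\lrcorner\, f$, i.e. by constant coefficient differential operators: each $x\in S^1$ acts as the $K$-derivation of $S_\bullet$ with $x\,\lrcorner\, y=a(x,y)$ for $y\in S_1$, and $(st)\,\lrcorner\, f=s\,\lrcorner\,(t\,\lrcorner\, f)$. For $f\in S_4$, let the (Waring) rank $\operatorname{rk} f$ be the minimum number $r$ of summands in an expression $f=x_1^4+\cdots+x_r^4$ with $x_i\in S_1$. Let $f\in S_4$. If there exists a nonzero $l\in S^1$ such that $l^2\,\lrcorner\, f=0$, then $\operatorname{rk} f\le 7$. -/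

import Mathlib

namespace Apolarity

/-- The degree `d` component `S^d V` of the symmetric algebra of `V`. -/
def homogeneousPart (K : Type*) (V : Type*) [Field K] [AddCommGroup V] [Module K V] (d : ℕ) :
    Submodule K (SymmetricAlgebra K V) :=
  LinearMap.range (SymmetricAlgebra.ι K V) ^ d

/-- The Waring rank of a form `f` of degree `d`: the minimum number of summands needed to write
`f` as a sum of `d`-th powers of linear forms (and `⊤` if there is no such expression). -/
noncomputable def waringRank {K : Type*} {V : Type*} [Field K] [AddCommGroup V] [Module K V]
    (d : ℕ) (f : SymmetricAlgebra K V) : ℕ∞ :=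
  sInf {n : ℕ∞ | ∃ r : ℕ, n = (r : ℕ∞) ∧
    ∃ x : Fin r → V, f = ∑ i, SymmetricAlgebra.ι K V (x i) ^ d}

section Contraction

variable {K : Type*} {V : Type*} {W : Type*} [Field K] [AddCommGroup V] [Module K V]
  [AddCommGroup W] [Module K W]

/-- Auxiliary algebra map `S W → (S W)[ε]`, sending a vector `y` to `y + φ(y) ε`. -/
noncomputable def dualNumberLift (φ : W →ₗ[K] K) :
    SymmetricAlgebra K W →ₐ[K] TrivSqZeroExt (SymmetricAlgebra K W) (SymmetricAlgebra K W) :=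
  SymmetricAlgebra.lift
    ((TrivSqZeroExt.inlAlgHom K (SymmetricAlgebra K W) (SymmetricAlgebra K W)).toLinearMap ∘ₗ
        SymmetricAlgebra.ι K W +
      (TrivSqZeroExt.inrHom (SymmetricAlgebra K W) (SymmetricAlgebra K W)).restrictScalars K ∘ₗ
        Algebra.linearMap K (SymmetricAlgebra K W) ∘ₗ φ)

theorem fst_dualNumberLift (φ : W →ₗ[K] K) (f : SymmetricAlgebra K W) :
    (dualNumberLift φ f).fst = f := by
  have h : (TrivSqZeroExt.fstHom K (SymmetricAlgebra K W) (SymmetricAlgebra K W)).comp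
      (dualNumberLift φ) = AlgHom.id K _ := by
    apply SymmetricAlgebra.algHom_ext
    ext y
    simp [dualNumberLift]
  exact DFunLike.congr_fun h f

/-- The directional derivative: the unique `K`-derivation of `S W` that restricts to the linear
form `φ` on `W`. -/
noncomputable def derivationOf (φ : W →ₗ[K] K) :
    Derivation K (SymmetricAlgebra K W) (SymmetricAlgebra K W) :=
  Derivation.mk'
    ((TrivSqZeroExt.sndHom (SymmetricAlgebra K W) (SymmetricAlgebra K W)).restrictScalars K ∘ₗ
      (dualNumberLift φ).toLinearMap)
    (by
      intro f g
      simp [fst_dualNumberLift, mul_comm])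

theorem derivationOf_ι (φ : W →ₗ[K] K) (y : W) :
    derivationOf φ (SymmetricAlgebra.ι K W y) = algebraMap K _ (φ y) := by
  simp [derivationOf, dualNumberLift, Algebra.algebraMap_eq_smul_one]

theorem derivation_ext {D E : Derivation K (SymmetricAlgebra K W) (SymmetricAlgebra K W)}
    (h : ∀ y, D (SymmetricAlgebra.ι K W y) = E (SymmetricAlgebra.ι K W y)) : D = E := by
  ext f
  induction f using SymmetricAlgebra.induction with
  | algebraMap r => simp
  | ι x => exact h x
  | mul p q hp hq => simp [hp, hq]
  | add p q hp hq => simp [hp, hq]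

/-- A vector of `V` acts on `S W` as the directional derivative given by the pairing. -/
noncomputable def linearAction (a : V →ₗ[K] W →ₗ[K] K) :
    V →ₗ[K] Module.End K (SymmetricAlgebra K W) where
  toFun x := (derivationOf (a x)).toLinearMap
  map_add' x y := by
    have h : derivationOf (a (x + y)) = derivationOf (a x) + derivationOf (a y) :=
      derivation_ext fun z => by simp [derivationOf_ι]
    rw [h]; rfl
  map_smul' c x := by
    have h : derivationOf (a (c • x)) = c • derivationOf (a x) :=
      derivation_ext fun z => by simp [derivationOf_ι, Algebra.smul_def]
    rw [h]; rfl

theorem linearAction_comm (a : V →ₗ[K] W →ₗ[K] K) (x y : V) :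
    linearAction a x * linearAction a y = linearAction a y * linearAction a x := by
  have h : ⁅derivationOf (a x), derivationOf (a y)⁆ = 0 :=
    derivation_ext fun z => by simp [Derivation.commutator_apply, derivationOf_ι]
  ext f
  have := DFunLike.congr_fun h f
  rw [Derivation.commutator_apply] at this
  exact sub_eq_zero.mp this

/-- Contraction. For `s` in `S V` and `f` in `S W`, the element `contract a s f` is the contraction
of `f` by `s` with respect to the pairing `a` of `V` and `W`: this is the action of `S V` on `S W`
by constant coefficient differential operators, that is, the unique `K`-algebra homomorphism
`S V → End (S W)` that sends each `x` in `V` to the derivation of `S W` which maps each `y` in `W`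
to the scalar `a x y`. -/
noncomputable def contract (a : V →ₗ[K] W →ₗ[K] K) :
    SymmetricAlgebra K V →ₐ[K] Module.End K (SymmetricAlgebra K W) :=
  RingCon.liftₐ (TensorAlgebra.symRingCon K V) (TensorAlgebra.lift K (linearAction a)) (by
    refine RingCon.ringConGen_le.2 fun p q h => ?_
    induction h with
    | mul_comm x y =>
      rw [RingCon.ker_apply]
      simpa using linearAction_comm a x y)

theorem contract_ι (a : V →ₗ[K] W →ₗ[K] K) (x : V) (f : SymmetricAlgebra K W) :
    contract a (SymmetricAlgebra.ι K V x) f = derivationOf (a x) f := by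
  have h : contract a (SymmetricAlgebra.ι K V x) = linearAction a x :=
    (RingCon.liftₐ_mk _ _ _ _).trans (TensorAlgebra.lift_ι_apply _ x)
  rw [h]; rfl

theorem contract_ι_ι (a : V →ₗ[K] W →ₗ[K] K) (x : V) (y : W) :
    contract a (SymmetricAlgebra.ι K V x) (SymmetricAlgebra.ι K W y) =
      algebraMap K _ (a x y) := by
  rw [contract_ι, derivationOf_ι]

theorem contract_ι_mul (a : V →ₗ[K] W →ₗ[K] K) (x : V) (f g : SymmetricAlgebra K W) :
    contract a (SymmetricAlgebra.ι K V x) (f * g) =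
      contract a (SymmetricAlgebra.ι K V x) f * g +
        f * contract a (SymmetricAlgebra.ι K V x) g := by
  simp only [contract_ι, Derivation.leibniz, smul_eq_mul]
  ring

theorem contract_mul (a : V →ₗ[K] W →ₗ[K] K) (s t : SymmetricAlgebra K V)
    (f : SymmetricAlgebra K W) : contract a (s * t) f = contract a s (contract a t f) := by
  rw [map_mul]; rfl

end Contraction

end Apolarity

namespace Apolarity

section PowerSums

variable {K : Type*} {W : Type*} [Field K] [AddCommGroup W] [Module K W]

local notation "ι" => SymmetricAlgebra.ι K W

/-! Choose `z` with `a l z = 1` and a basis `x, y` of `ker (a l)`. Contraction by `l` behaves like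
`∂/∂z`, so `l² ⌟ f = 0` forces `f = z C + G` with `C` a binary cubic and `G` a binary quartic in `x,
y`. It remains to write every such form with seven powers.

If `C ≠ 0` has no triple root, there are three forms `pᵢ` in `x, y` with `∑ μᵢ pᵢ = 0` and `∑ μᵢ
pᵢ³` proportional to `C`. Two powers on the line through `pᵢ` and `z` give `mᵢ pᵢ⁴ + 4 μᵢ pᵢ³ z` up
to an error in `pᵢ z³` and `z⁴`, and the three errors cancel (`isSumOfFourthPowers_six`). Shifting
`z` by a form in `x, y` changes `G` by a multiple of `C`; this freedom, the weights `mᵢ` and a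
seventh power account for all of `G`. If `C` is a cube or zero, four powers give the part divisible
by `x³` and three give the rest. -/

/-- `f` is a sum of `n` fourth powers of linear forms. -/
def IsSumOfFourthPowers (n : ℕ) (f : SymmetricAlgebra K W) : Prop :=
  ∃ v : Fin n → W, f = ∑ i, ι (v i) ^ 4

theorem IsSumOfFourthPowers.add {m n : ℕ} {f g : SymmetricAlgebra K W}
    (hf : IsSumOfFourthPowers m f) (hg : IsSumOfFourthPowers n g) :
    IsSumOfFourthPowers (m + n) (f + g) := by
  obtain ⟨v, rfl⟩ := hf
  obtain ⟨w, rfl⟩ := hg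
  exact ⟨Fin.append v w, by simp [Fin.sum_univ_add]⟩

theorem IsSumOfFourthPowers.waringRank_le {n : ℕ} {f : SymmetricAlgebra K W}
    (hf : IsSumOfFourthPowers n f) : waringRank 4 f ≤ n :=
  sInf_le ⟨n, rfl, hf⟩

theorem isSumOfFourthPowers_smul_pow [IsAlgClosed K] (c : K) (w : W) :
    IsSumOfFourthPowers 1 (c • ι w ^ 4) := by
  obtain ⟨t, ht⟩ := IsAlgClosed.exists_pow_nat_eq c (n := 4) (by norm_num)
  exact ⟨fun _ => t • w, by simp [smul_pow, ht]⟩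

/-! ### Pairs of powers on three concurrent lines -/

/-- Two fourth powers on the line through `p` and `z`. -/
theorem isSumOfFourthPowers_pair [IsAlgClosed K] [CharZero K] {m μ κ : K} (hμ : μ ≠ 0)
    (h : κ ^ 2 * m ^ 2 ≠ 4 * κ * μ ^ 2) (p z : W) :
    IsSumOfFourthPowers 2 (m • ι p ^ 4 + (4 * μ) • (ι p ^ 3 * ι z)
      - (4 * κ * μ) • (ι p * ι z ^ 3) - (κ ^ 2 * m) • ι z ^ 4) := by
  -- The nodes `t₁, t₂` are the roots of `t² - s t + κ`, with discriminant `d²`, nonzero by `h`.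
  obtain ⟨d, hd⟩ := IsAlgClosed.exists_pow_nat_eq ((κ * m / μ) ^ 2 - 4 * κ) (n := 2) (by norm_num)
  have hd0 : d ≠ 0 := by
    rintro rfl
    field_simp at hd
    apply h
    linear_combination -hd
  obtain ⟨s, hs⟩ : ∃ s, s = κ * m / μ := ⟨_, rfl⟩
  have hs' : s * μ = κ * m := by rw [hs]; field_simp
  rw [← hs] at hd
  obtain ⟨t₁, ht₁⟩ : ∃ t, t = (s + d) / 2 := ⟨_, rfl⟩
  obtain ⟨t₂, ht₂⟩ : ∃ t, t = (s - d) / 2 := ⟨_, rfl⟩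
  have hsum : t₁ + t₂ = s := by rw [ht₁, ht₂]; ring
  have hdiff : t₁ - t₂ = d := by rw [ht₁, ht₂]; ring
  have hprod : t₁ * t₂ = κ := by rw [ht₁, ht₂]; linear_combination -hd / 4
  -- The weights solve for the moments of order 0 and 1. The recurrence `Mⱼ₊₂ = s Mⱼ₊₁ - κ Mⱼ` gives
  -- the others; `s = κ m / μ` is what kills `M₂`, the coefficient of `p² z²`.
  obtain ⟨α, hα⟩ : ∃ t, t = (μ - m * t₂) / d := ⟨_, rfl⟩
  obtain ⟨β, hβ⟩ : ∃ t, t = (m * t₁ - μ) / d := ⟨_, rfl⟩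
  have m0 : α + β = m := by
    rw [hα, hβ]; field_simp; linear_combination m * hdiff
  have m1 : α * t₁ + β * t₂ = μ := by
    rw [hα, hβ]; field_simp; linear_combination μ * hdiff
  have m2 : α * t₁ ^ 2 + β * t₂ ^ 2 = 0 := by
    linear_combination (t₁ + t₂) * m1 - t₁ * t₂ * m0 + μ * hsum - m * hprod + hs'
  have m3 : α * t₁ ^ 3 + β * t₂ ^ 3 = -(κ * μ) := by
    linear_combination (t₁ + t₂) * m2 - t₁ * t₂ * m1 - μ * hprod
  have m4 : α * t₁ ^ 4 + β * t₂ ^ 4 = -(κ ^ 2 * m) := by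
    linear_combination (t₁ + t₂) * m3 - t₁ * t₂ * m2 - κ * μ * hsum - κ * hs'
  convert (isSumOfFourthPowers_smul_pow α (p + t₁ • z)).add
    (isSumOfFourthPowers_smul_pow β (p + t₂ • z)) using 1
  replace m0 := congrArg (algebraMap K (SymmetricAlgebra K W)) m0
  replace m1 := congrArg (algebraMap K (SymmetricAlgebra K W)) m1
  replace m2 := congrArg (algebraMap K (SymmetricAlgebra K W)) m2
  replace m3 := congrArg (algebraMap K (SymmetricAlgebra K W)) m3
  replace m4 := congrArg (algebraMap K (SymmetricAlgebra K W)) m4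
  simp only [map_add, map_mul, map_pow, map_neg, map_zero] at m0 m1 m2 m3 m4
  simp only [map_add, map_smul, Algebra.smul_def, map_mul, map_pow, map_ofNat]
  linear_combination -(ι p ^ 4 * m0 + 4 * ι p ^ 3 * ι z * m1 + 6 * ι p ^ 2 * ι z ^ 2 * m2
    + 4 * ι p * ι z ^ 3 * m3 + ι z ^ 4 * m4)

-- With the same `κ` on all three lines, the errors add up to `-4κ z³ ∑ μᵢ pᵢ - κ² z⁴ ∑ mᵢ = 0`.
open scoped Classical in
theorem isSumOfFourthPowers_six [IsAlgClosed K] [CharZero K] (p : Fin 3 → W) (z : W)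
    (μ m : Fin 3 → K) (hμ : ∀ i, μ i ≠ 0) (hp : ∑ i, μ i • p i = 0) (hm : ∑ i, m i = 0) :
    IsSumOfFourthPowers 6 (∑ i, (m i • ι (p i) ^ 4 + (4 * μ i) • (ι (p i) ^ 3 * ι z))) := by
  -- Only finitely many `κ` are bad. Where `m i = 0` the quotient is the junk value `0`, which is
  -- harmless since `μ i ≠ 0` already excludes equality.
  obtain ⟨κ, hκ⟩ := Set.Infinite.exists_notMem_finset (Set.infinite_univ (α := K))
    (insert 0 (Finset.univ.image fun i => 4 * μ i ^ 2 / m i ^ 2))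
  have hκ0 : κ ≠ 0 := by rintro rfl; simp at hκ
  have h : ∀ i, κ ^ 2 * m i ^ 2 ≠ 4 * κ * μ i ^ 2 := by
    intro i hi
    have hi' : κ * m i ^ 2 = 4 * μ i ^ 2 :=
      mul_left_cancel₀ hκ0 (by linear_combination hi)
    by_cases h0 : m i = 0
    · simp [h0, hμ i] at hi'
    · apply hκ.2
      simp only [Finset.mem_insert, Finset.mem_image, Finset.mem_univ, true_and]
      exact Or.inr ⟨i, by rw [← hi']; field_simp⟩
  convert ((isSumOfFourthPowers_pair (hμ 0) (h 0) (p 0) z).add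
    (isSumOfFourthPowers_pair (hμ 1) (h 1) (p 1) z)).add
    (isSumOfFourthPowers_pair (hμ 2) (h 2) (p 2) z) using 1
  replace hp := congrArg ι hp
  replace hm := congrArg (algebraMap K (SymmetricAlgebra K W)) hm
  simp only [Fin.sum_univ_three, map_add, map_smul, Algebra.smul_def, map_zero] at hp hm
  simp only [Fin.sum_univ_three, Algebra.smul_def, map_mul, map_pow, map_ofNat]
  linear_combination 4 * algebraMap K _ κ * ι z ^ 3 * hp + algebraMap K _ κ ^ 2 * ι z ^ 4 * hm

/-- The product of a cube of a linear form and a linear form. -/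
theorem isSumOfFourthPowers_cube_mul [IsAlgClosed K] [CharZero K] (x w : W) :
    IsSumOfFourthPowers 4 (ι x ^ 3 * ι w) := by
  -- Differences of opposite nodes leave only `x³w` and `xw³`; the weights `8` and `-1` cancel `xw³`
  -- and leave `48 x³w`.
  convert (((isSumOfFourthPowers_smul_pow (8 / 48 : K) (x + w)).add
    (isSumOfFourthPowers_smul_pow (-8 / 48 : K) (x - w))).add
    (isSumOfFourthPowers_smul_pow (-1 / 48 : K) (x + (2 : K) • w))).add
    (isSumOfFourthPowers_smul_pow (1 / 48 : K) (x - (2 : K) • w)) using 1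
  have h : algebraMap K (SymmetricAlgebra K W) (1 / 48) * 48 = 1 := by
    rw [← map_ofNat (algebraMap K (SymmetricAlgebra K W)), ← map_mul]; norm_num
  rw [show (8 / 48 : K) = 8 * (1 / 48) by ring, show (-8 / 48 : K) = -(8 * (1 / 48)) by ring,
    show (-1 / 48 : K) = -(1 / 48) by ring]
  simp only [map_add, map_sub, map_smul, Algebra.smul_def, map_mul, map_neg, map_ofNat]
  linear_combination -(ι x ^ 3 * ι w) * h

/-! ### Coefficients of binary forms -/

/-- Splitting off the multiples of `z` in a power of `span {z} ⊔ M`. -/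
theorem exists_of_mem_sup_pow {R A : Type*} [CommSemiring R] [CommSemiring A] [Algebra R A]
    (z : A) (M : Submodule R A) (n : ℕ) {f : A}
    (hf : f ∈ (Submodule.span R {z} ⊔ M) ^ (n + 1)) :
    ∃ g ∈ (Submodule.span R {z} ⊔ M) ^ n, ∃ m ∈ M ^ (n + 1), f = z * g + m := by
  have key : (Submodule.span R {z} ⊔ M) ^ (n + 1) ≤
      Submodule.span R {z} * (Submodule.span R {z} ⊔ M) ^ n ⊔ M ^ (n + 1) := by
    clear hf
    induction n with
    | zero => simp
    | succ n ih =>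
      rw [pow_succ' _ (n + 1), Submodule.sup_mul]
      refine sup_le le_sup_left ?_
      refine (mul_le_mul_right ih M).trans ?_
      rw [Submodule.mul_sup, ← pow_succ']
      refine sup_le_sup_right ?_ _
      rw [mul_left_comm]
      refine mul_le_mul_right ?_ _
      rw [pow_succ']
      exact mul_le_mul_left le_sup_right _
  obtain ⟨u, hu, m, hm, rfl⟩ := Submodule.mem_sup.1 (key hf)
  obtain ⟨g, hg, rfl⟩ := Submodule.mem_span_singleton_mul.1 hu
  exact ⟨g, hg, m, hm, rfl⟩

theorem exists_of_mem_span_singleton_pow {R A : Type*} [CommSemiring R] [CommSemiring A]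
    [Algebra R A] {y : A} {n : ℕ} {f : A} (hf : f ∈ Submodule.span R {y} ^ n) :
    ∃ c : R, f = c • y ^ n := by
  rw [Submodule.span_pow, Set.singleton_pow] at hf
  obtain ⟨c, rfl⟩ := Submodule.mem_span_singleton.1 hf
  exact ⟨c, rfl⟩

theorem exists_binary_cubic {R A : Type*} [CommSemiring R] [CommSemiring A] [Algebra R A]
    {x y f : A} (hf : f ∈ Submodule.span R {x, y} ^ 3) :
    ∃ a b c d : R, f = a • x ^ 3 + b • (x ^ 2 * y) + c • (x * y ^ 2) + d • y ^ 3 := by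
  rw [Submodule.span_insert] at hf
  obtain ⟨f₂, hf₂, m₃, h₃, rfl⟩ := exists_of_mem_sup_pow _ _ 2 hf
  obtain ⟨f₁, hf₁, m₂, h₂, rfl⟩ := exists_of_mem_sup_pow _ _ 1 hf₂
  obtain ⟨f₀, hf₀, m₁, h₁, rfl⟩ := exists_of_mem_sup_pow _ _ 0 hf₁
  rw [pow_zero] at hf₀
  obtain ⟨d, rfl⟩ := exists_of_mem_span_singleton_pow h₃
  obtain ⟨c, rfl⟩ := exists_of_mem_span_singleton_pow h₂
  obtain ⟨b, rfl⟩ := exists_of_mem_span_singleton_pow h₁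
  obtain ⟨a, rfl⟩ := Submodule.mem_one.1 hf₀
  refine ⟨a, b, c, d, ?_⟩
  simp only [Algebra.smul_def]
  ring

theorem exists_binary_quartic {R A : Type*} [CommSemiring R] [CommSemiring A] [Algebra R A]
    {x y f : A} (hf : f ∈ Submodule.span R {x, y} ^ 4) :
    ∃ a b c d e : R, f = a • x ^ 4 + b • (x ^ 3 * y) + c • (x ^ 2 * y ^ 2) + d • (x * y ^ 3)
      + e • y ^ 4 := by
  rw [Submodule.span_insert] at hf
  obtain ⟨g, hg, m, hm, rfl⟩ := exists_of_mem_sup_pow _ _ 3 hf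
  rw [← Submodule.span_insert] at hg
  obtain ⟨a, b, c, d, rfl⟩ := exists_binary_cubic hg
  obtain ⟨e, rfl⟩ := exists_of_mem_span_singleton_pow hm
  refine ⟨a, b, c, d, e, ?_⟩
  simp only [Algebra.smul_def]
  ring

/-! ### Seven powers, by the root type of the cubic -/

/-- Uses `x³ + y³ - (x + y)³ = -3xy(x + y)`. Modulo multiples of this cubic, `x⁴`, `y⁴` and `(x +
y)⁴` span the binary quartics; the seventh power frees the weights from `∑ mᵢ = 0`. -/
theorem isSumOfFourthPowers_of_three_roots [IsAlgClosed K] [CharZero K] {x y z : W} {k : K}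
    {G : SymmetricAlgebra K W} (hG : G ∈ Submodule.span K {ι x, ι y} ^ 4) :
    IsSumOfFourthPowers 7 (k • (ι x * ι y * (ι x + ι y) * ι z) + G) := by
  obtain ⟨a, b, c, d, e, rfl⟩ := exists_binary_quartic hG
  -- This `n` makes `G - n (x + y)⁴`, apart from its `x⁴` and `y⁴` terms, divisible by `xy(x + y)`.
  obtain ⟨n, hn⟩ : ∃ n, n = (b + d - c) / 2 := ⟨_, rfl⟩
  have hc : c = b + d - 2 * n := by rw [hn]; ring
  convert (isSumOfFourthPowers_six ![x, y, -(x + y)]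
    ((-1 / 12 : K) • (k • z + (b - 4 * n) • x + (d - 4 * n) • y)) ![1, 1, 1]
    ![-(e - n) - n, e - n, n] (by simp [Fin.forall_fin_succ])
    (by simp [Fin.sum_univ_three]) (by simp [Fin.sum_univ_three]; ring)).add
    (isSumOfFourthPowers_smul_pow (a - n + e) x) using 1
  have h : algebraMap K (SymmetricAlgebra K W) (-1 / 12) * 12 = -1 := by
    rw [← map_ofNat (algebraMap K (SymmetricAlgebra K W)), ← map_mul]; norm_num
  simp only [hc, Fin.sum_univ_three, Matrix.cons_val, map_add, map_sub, map_smul, Algebra.smul_def,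
    map_mul, map_neg, map_ofNat, map_one]
  linear_combination (ι x * ι y * (ι x + ι y) *
    (algebraMap K _ k * ι z + (algebraMap K _ b - 4 * algebraMap K _ n) * ι x
      + (algebraMap K _ d - 4 * algebraMap K _ n) * ι y)) * h

/-- Uses `(x + y)³ + (y - x)³ - 2y³ = 6x²y`. The shift of `z` absorbs `x³y` and `x²y²`; `m, n` match
`x⁴` and `xy³`, and the seventh power matches `y⁴`. -/
theorem isSumOfFourthPowers_of_double_root [IsAlgClosed K] [CharZero K] {x y z : W} {k : K}
    {G : SymmetricAlgebra K W} (hG : G ∈ Submodule.span K {ι x, ι y} ^ 4) :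
    IsSumOfFourthPowers 7 (k • (ι x ^ 2 * ι y * ι z) + G) := by
  obtain ⟨a, b, c, d, e, rfl⟩ := exists_binary_quartic hG
  obtain ⟨m, hm⟩ : ∃ n, n = (a + d / 4) / 2 := ⟨_, rfl⟩
  obtain ⟨n, hn⟩ : ∃ n, n = (a - d / 4) / 2 := ⟨_, rfl⟩
  have ha : a = m + n := by rw [hm, hn]; ring
  have hd : d = 4 * (m - n) := by rw [hm, hn]; ring
  convert (isSumOfFourthPowers_six ![x + y, y - x, y]
    ((1 / 24 : K) • (k • z + (b - d) • x + (c - 6 * a) • y)) ![1, 1, -2]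
    ![m, n, -m - n] (by simp [Fin.forall_fin_succ])
    (by simp [Fin.sum_univ_three]; module) (by simp [Fin.sum_univ_three])).add
    (isSumOfFourthPowers_smul_pow e y) using 1
  have h : algebraMap K (SymmetricAlgebra K W) (1 / 24) * 24 = 1 := by
    rw [← map_ofNat (algebraMap K (SymmetricAlgebra K W)), ← map_mul]; norm_num
  simp only [ha, hd, Fin.sum_univ_three, Matrix.cons_val, map_add, map_sub, map_smul,
    Algebra.smul_def, map_mul, map_neg, map_ofNat, map_one]
  linear_combination -(ι x ^ 2 * ι y *
    (algebraMap K _ k * ι z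
      + (algebraMap K _ b - 4 * (algebraMap K _ m - algebraMap K _ n)) * ι x
      + (algebraMap K _ c - 6 * (algebraMap K _ m + algebraMap K _ n)) * ι y)) * h

/-- The terms of `G` divisible by `x³` join the cube product; powers of `x + y`, `x - y` and `y`
match `x²y²`, `xy³` and `y⁴`. -/
theorem isSumOfFourthPowers_of_triple_root [IsAlgClosed K] [CharZero K] {x y z : W} {k : K}
    {G : SymmetricAlgebra K W} (hG : G ∈ Submodule.span K {ι x, ι y} ^ 4) :
    IsSumOfFourthPowers 7 (k • (ι x ^ 3 * ι z) + G) := by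
  obtain ⟨a, b, c, d, e, rfl⟩ := exists_binary_quartic hG
  obtain ⟨m, hm⟩ : ∃ n, n = (c / 6 + d / 4) / 2 := ⟨_, rfl⟩
  obtain ⟨n, hn⟩ : ∃ n, n = (c / 6 - d / 4) / 2 := ⟨_, rfl⟩
  have hc : c = 6 * (m + n) := by rw [hm, hn]; ring
  have hd : d = 4 * (m - n) := by rw [hm, hn]; ring
  convert (((isSumOfFourthPowers_cube_mul x (k • z + (a - (m + n)) • x + (b - d) • y)).add
    (isSumOfFourthPowers_smul_pow m (x + y))).add
    (isSumOfFourthPowers_smul_pow n (x - y))).add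
    (isSumOfFourthPowers_smul_pow (e - (m + n)) y) using 1
  simp only [hc, hd, map_add, map_sub, map_smul, Algebra.smul_def, map_mul, map_ofNat]
  ring

/-! ### Factoring the cubic and adapting the basis -/

/-- A binary cubic over an algebraically closed field is a product of linear forms. -/
theorem exists_linear_factors [IsAlgClosed K] {A : Type*} [CommRing A] [Algebra K A] (x y : A)
    (a b c d : K) : ∃ p q : Fin 3 → K,
      a • x ^ 3 + b • (x ^ 2 * y) + c • (x * y ^ 2) + d • y ^ 3 = ∏ i, (p i • x + q i • y) := by
  have quad : ∀ a b c : K, ∃ p q r s : K,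
      a • x ^ 2 + b • (x * y) + c • y ^ 2 = (p • x + q • y) * (r • x + s • y) := by
    intro a b c
    by_cases ha : a = 0
    · exact ⟨0, 1, b, c, by simp only [ha, Algebra.smul_def, map_zero, map_one]; ring⟩
    obtain ⟨t, ht⟩ := IsAlgClosed.exists_root
      (Polynomial.C a * .X ^ 2 + Polynomial.C b * .X + Polynomial.C c)
      (by rw [Polynomial.degree_quadratic ha]; norm_num)
    simp only [Polynomial.IsRoot, Polynomial.eval_add, Polynomial.eval_mul, Polynomial.eval_pow,
      Polynomial.eval_C, Polynomial.eval_X] at ht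
    refine ⟨1, -t, a, b + a * t, ?_⟩
    replace ht := congrArg (algebraMap K A) ht
    simp only [map_add, map_mul, map_pow, map_zero] at ht
    simp only [Algebra.smul_def, map_one, map_add, map_mul, map_neg]
    linear_combination y ^ 2 * ht
  obtain ⟨p, q, a', b', c', h⟩ : ∃ p q a' b' c' : K,
      a • x ^ 3 + b • (x ^ 2 * y) + c • (x * y ^ 2) + d • y ^ 3 =
        (p • x + q • y) * (a' • x ^ 2 + b' • (x * y) + c' • y ^ 2) := by
    -- A vanishing leading coefficient is a root at infinity, with factor `y`.
    by_cases ha : a = 0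
    · exact ⟨0, 1, b, c, d, by simp only [ha, Algebra.smul_def, map_zero, map_one]; ring⟩
    obtain ⟨t, ht⟩ := IsAlgClosed.exists_root
      (Polynomial.C a * .X ^ 3 + Polynomial.C b * .X ^ 2 + Polynomial.C c * .X + Polynomial.C d)
      (by rw [Polynomial.degree_cubic ha]; norm_num)
    simp only [Polynomial.IsRoot, Polynomial.eval_add, Polynomial.eval_mul, Polynomial.eval_pow,
      Polynomial.eval_C, Polynomial.eval_X] at ht
    refine ⟨1, -t, a, b + a * t, c + b * t + a * t ^ 2, ?_⟩
    replace ht := congrArg (algebraMap K A) ht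
    simp only [map_add, map_mul, map_pow, map_zero] at ht
    simp only [Algebra.smul_def, map_one, map_add, map_mul, map_neg, map_pow]
    linear_combination y ^ 3 * ht
  obtain ⟨r, s, u, v, h'⟩ := quad a' b' c'
  exact ⟨![p, r, u], ![q, s, v], by rw [h, h']; simp [Fin.prod_univ_three, mul_assoc]⟩

/-- Change of basis in the space of binary forms of degree `n`. -/
theorem mem_span_pair_pow_of_det_ne_zero {A : Type*} [CommRing A] [Algebra K A] {x y G : A}
    {p q r s : K} (h : p * s - q * r ≠ 0) {n : ℕ} (hG : G ∈ Submodule.span K {x, y} ^ n) :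
    G ∈ Submodule.span K {p • x + q • y, r • x + s • y} ^ n := by
  refine pow_le_pow_left' (Submodule.span_le.2 ?_) n hG
  rintro w (rfl | rfl)
  · refine Submodule.mem_span_pair.2
      ⟨(p * s - q * r)⁻¹ * s, (p * s - q * r)⁻¹ * -q, ?_⟩
    match_scalars
    · linear_combination inv_mul_cancel₀ h
    · ring
  · refine Submodule.mem_span_pair.2
      ⟨(p * s - q * r)⁻¹ * -r, (p * s - q * r)⁻¹ * p, ?_⟩
    match_scalars
    · ring
    · linear_combination inv_mul_cancel₀ h

theorem exists_eq_mul_of_det_eq_zero {p q r s : K} (h : p * s - q * r = 0)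
    (h0 : ¬ (p = 0 ∧ q = 0)) : ∃ t, r = t * p ∧ s = t * q := by
  by_cases hp : p = 0
  · have hq : q ≠ 0 := fun hq => h0 ⟨hp, hq⟩
    have hr : r = 0 := by simpa [hp, hq] using h
    exact ⟨s / q, by simp [hp, hr], by field_simp⟩
  · refine ⟨r / p, by field_simp, ?_⟩
    field_simp
    linear_combination h

/-- A ternary quartic of degree at most one in `z` is a sum of seven fourth powers. -/
theorem isSumOfFourthPowers_seven [IsAlgClosed K] [CharZero K] {x y z : W}
    {C G : SymmetricAlgebra K W} (hC : C ∈ Submodule.span K {ι x, ι y} ^ 3)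
    (hG : G ∈ Submodule.span K {ι x, ι y} ^ 4) :
    IsSumOfFourthPowers 7 (ι z * C + G) := by
  obtain ⟨a, b, c, d, rfl⟩ := exists_binary_cubic hC
  obtain ⟨p, q, h⟩ := exists_linear_factors (ι x) (ι y) a b c d
  rw [h, Fin.prod_univ_three]
  have basis : ∀ p q r s : K, p * s - q * r ≠ 0 →
      G ∈ Submodule.span K {ι (p • x + q • y), ι (r • x + s • y)} ^ 4 := by
    intro p q r s hdet
    simpa using mem_span_pair_pow_of_det_ne_zero hdet hG
  by_cases h0 : p 0 = 0 ∧ q 0 = 0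
  · simpa [h0.1, h0.2] using isSumOfFourthPowers_of_triple_root (z := z) (k := 0) hG
  by_cases h1 : p 0 * q 1 - q 0 * p 1 = 0
  · obtain ⟨t, ht, ht'⟩ := exists_eq_mul_of_det_eq_zero h1 h0
    by_cases h2 : p 0 * q 2 - q 0 * p 2 = 0
    · obtain ⟨u, hu, hu'⟩ := exists_eq_mul_of_det_eq_zero h2 h0
      -- All factors are proportional, so the first is completed to a basis by `x` or `y`.
      obtain ⟨r, s, hrs⟩ : ∃ r s, p 0 * s - q 0 * r ≠ 0 := by
        by_cases hp : p 0 = 0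
        · exact ⟨1, 0, by simpa [hp] using h0⟩
        · exact ⟨0, 1, by simpa using hp⟩
      convert isSumOfFourthPowers_of_triple_root (z := z) (k := t * u) (basis _ _ _ _ hrs) using 2
      simp only [ht, ht', hu, hu', map_add, map_smul, Algebra.smul_def, map_mul]
      ring
    · convert isSumOfFourthPowers_of_double_root (z := z) (k := t) (basis _ _ _ _ h2) using 2
      simp only [ht, ht', map_add, map_smul, Algebra.smul_def, map_mul]
      ring
  -- Cramer's rule expresses the third factor by the first two; `α = 0` or `β = 0` means a repeated
  -- root.
  · obtain ⟨α, β, hα, hβ⟩ : ∃ α β : K, p 2 = α * p 0 + β * p 1 ∧ q 2 = α * q 0 + β * q 1 := by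
      refine ⟨(p 0 * q 1 - q 0 * p 1)⁻¹ * (p 2 * q 1 - q 2 * p 1),
        (p 0 * q 1 - q 0 * p 1)⁻¹ * (p 0 * q 2 - q 0 * p 2), ?_, ?_⟩
      · linear_combination -p 2 * inv_mul_cancel₀ h1
      · linear_combination -q 2 * inv_mul_cancel₀ h1
    by_cases hα0 : α = 0
    · have h1' : p 1 * q 0 - q 1 * p 0 ≠ 0 := fun h' => h1 (by linear_combination -h')
      convert isSumOfFourthPowers_of_double_root (z := z) (k := β) (basis _ _ _ _ h1') using 2
      simp only [hα, hβ, hα0, map_add, map_smul, Algebra.smul_def, map_mul, map_zero]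
      ring
    by_cases hβ0 : β = 0
    · convert isSumOfFourthPowers_of_double_root (z := z) (k := α) (basis _ _ _ _ h1) using 2
      simp only [hα, hβ, hβ0, map_add, map_smul, Algebra.smul_def, map_mul, map_zero]
      ring
    -- Rescaling the first two factors by `α` and `β` makes the third their sum, at the cost of
    -- `(αβ)⁻¹`.
    have h1' : (α * p 0) * (β * q 1) - (α * q 0) * (β * p 1) ≠ 0 := fun h' =>
      h1 (mul_left_cancel₀ (mul_ne_zero hα0 hβ0) (by linear_combination h'))
    convert isSumOfFourthPowers_of_three_roots (z := z) (k := (α * β)⁻¹)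
      (basis _ _ _ _ h1') using 2
    have hu : algebraMap K (SymmetricAlgebra K W) (α * β)⁻¹ *
        (algebraMap K _ α * algebraMap K _ β) = 1 := by
      rw [← map_mul, ← map_mul, inv_mul_cancel₀ (mul_ne_zero hα0 hβ0), map_one]
    simp only [hα, hβ, map_add, map_smul, Algebra.smul_def, map_mul]
    linear_combination (-(algebraMap K _ (p 0) * ι x + algebraMap K _ (q 0) * ι y) *
      (algebraMap K _ (p 1) * ι x + algebraMap K _ (q 1) * ι y) *
      (algebraMap K _ α * (algebraMap K _ (p 0) * ι x + algebraMap K _ (q 0) * ι y)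
      + algebraMap K _ β * (algebraMap K _ (p 1) * ι x + algebraMap K _ (q 1) * ι y)) * ι z) * hu

/-! ### Degree in `z` via the derivation -/

/-- A derivation killing `M` kills its powers. -/
theorem derivation_eq_zero_of_mem_pow {R A : Type*} [CommRing R] [CommRing A] [Algebra R A]
    (D : Derivation R A A) {M : Submodule R A} (hM : ∀ m ∈ M, D m = 0) (n : ℕ) {f : A}
    (hf : f ∈ M ^ n) : D f = 0 := by
  induction n generalizing f with
  | zero =>
    obtain ⟨r, rfl⟩ := Submodule.mem_one.1 (by simpa using hf)
    simp
  | succ n ih =>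
    rw [pow_succ] at hf
    induction hf using Submodule.mul_induction_on' with
    | mem_mul_mem g hg m hm => simp [ih hg, hM m hm]
    | add g _ h _ hg hh => simp [hg, hh]

/-- Expand `f` in powers of `z` and differentiate `D² f = 0` twice more. The top coefficients then
vanish one by one in characteristic zero, without any algebraic independence of `z` over `M`. -/
theorem exists_eq_mul_add_of_derivation_sq_eq_zero {A : Type*} [CommRing A]
    [Algebra K A] [CharZero K] (D : Derivation K A A) {M : Submodule K A} {z f : A}
    (hM : ∀ m ∈ M, D m = 0) (hz : D z = 1) (hf : f ∈ (Submodule.span K {z} ⊔ M) ^ 4)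
    (hD : D (D f) = 0) : ∃ C ∈ M ^ 3, ∃ G ∈ M ^ 4, f = z * C + G := by
  obtain ⟨f₃, hf₃, m₄, h₄, rfl⟩ := exists_of_mem_sup_pow _ _ 3 hf
  obtain ⟨f₂, hf₂, m₃, h₃, rfl⟩ := exists_of_mem_sup_pow _ _ 2 hf₃
  obtain ⟨f₁, hf₁, m₂, h₂, rfl⟩ := exists_of_mem_sup_pow _ _ 1 hf₂
  obtain ⟨f₀, hf₀, m₁, h₁, rfl⟩ := exists_of_mem_sup_pow _ _ 0 hf₁
  have e₀ := derivation_eq_zero_of_mem_pow D hM 0 (show f₀ ∈ M ^ 0 by simpa using hf₀)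
  have e₁ := derivation_eq_zero_of_mem_pow D hM _ h₁
  have e₂ := derivation_eq_zero_of_mem_pow D hM _ h₂
  have e₃ := derivation_eq_zero_of_mem_pow D hM _ h₃
  have e₄ := derivation_eq_zero_of_mem_pow D hM _ h₄
  have cancel : ∀ (c : ℕ), c ≠ 0 → ∀ g : A, (c : A) * g = 0 → g = 0 := by
    intro c hc g hg
    have hc' : (c : K) ≠ 0 := Nat.cast_ne_zero.2 hc
    have : (c : K) • g = 0 := by rw [Algebra.smul_def, map_natCast, hg]
    exact (smul_eq_zero.1 this).resolve_left hc'
  have d₁ : ∀ g, D (z * g) = g + z * D g := by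
    intro g; simp [hz]; ring
  have hD2 : ((12 : ℕ) : A) * (z * (z * f₀)) + ((6 : ℕ) : A) * (z * m₁) + ((2 : ℕ) : A) * m₂
      = 0 := by
    simp only [d₁, map_add, e₀, e₁, e₂, e₃, e₄, map_zero] at hD
    push_cast
    linear_combination hD
  have dn : ∀ (n : ℕ) g, D ((n : A) * g) = (n : A) * D g := by intro n g; simp
  have hD3 := congrArg D hD2
  simp only [map_add, dn, d₁, e₀, e₁, e₂, map_zero] at hD3
  have hD4 := congrArg D hD3
  simp only [map_add, dn, d₁, e₀, e₁, map_zero] at hD4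
  have z₀ : f₀ = 0 := cancel 24 (by norm_num) _ (by push_cast at hD4 ⊢; linear_combination hD4)
  subst z₀
  have z₁ : m₁ = 0 := cancel 6 (by norm_num) _ (by push_cast at hD3 ⊢; linear_combination hD3)
  subst z₁
  have z₂ : m₂ = 0 := cancel 2 (by norm_num) _ (by push_cast at hD2 ⊢; linear_combination hD2)
  subst z₂
  exact ⟨m₃, h₃, m₄, h₄, by ring⟩

end PowerSums

end Apolarity

/-! ### Coordinates adapted to `l` -/

theorem mainTheorem3 {K : Type*} [Field K] [IsAlgClosed K] [CharZero K]
    {V : Type*} [AddCommGroup V] [Module K V] {W : Type*} [AddCommGroup W] [Module K W]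
    (a : V →ₗ[K] W →ₗ[K] K) [a.IsPerfPair] (hW : Module.finrank K W = 3)
    (f : SymmetricAlgebra K W) (hf : f ∈ Apolarity.homogeneousPart K W 4)
    (l : V) (hl : l ≠ 0)
    (hlf : Apolarity.contract a (SymmetricAlgebra.ι K V l ^ 2) f = 0) :
    Apolarity.waringRank 4 f ≤ 7 := by
  have hal : a l ≠ 0 := fun h =>
    hl ((LinearMap.IsPerfPair.bijective_left (p := a)).injective (by rw [h, map_zero]))
  have : FiniteDimensional K W := Module.finite_of_finrank_pos (by omega)
  have hsurj : LinearMap.range (a l) = ⊤ :=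
    LinearMap.range_eq_top.2 (LinearMap.surjective hal)
  obtain ⟨z, hz⟩ := LinearMap.surjective hal 1
  have hker : Module.finrank K (LinearMap.ker (a l)) = 2 := by
    have := LinearMap.finrank_range_add_finrank_ker (a l)
    rw [hsurj, finrank_top, Module.finrank_self, hW] at this
    omega
  let b := Module.finBasisOfFinrankEq K _ hker
  have hb : ∀ u, a l u = 0 → u ∈ Submodule.span K {(b 0 : W), (b 1 : W)} := by
    intro u hu
    refine Submodule.mem_span_pair.2 ⟨b.repr ⟨u, hu⟩ 0, b.repr ⟨u, hu⟩ 1, ?_⟩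
    have h := congrArg (Submodule.subtype _) (b.sum_repr ⟨u, hu⟩)
    rwa [Fin.sum_univ_two, map_add, map_smul, map_smul] at h
  have hM : ∀ m ∈ Submodule.span K {SymmetricAlgebra.ι K W (b 0), SymmetricAlgebra.ι K W (b 1)},
      Apolarity.derivationOf (a l) m = 0 := by
    intro m hm
    obtain ⟨r, s, rfl⟩ := Submodule.mem_span_pair.1 hm
    have h0 : a l (b 0) = 0 := (b 0).2
    have h1 : a l (b 1) = 0 := (b 1).2
    simp [Apolarity.derivationOf_ι, h0, h1]
  have hrange : LinearMap.range (SymmetricAlgebra.ι K W) ≤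
      Submodule.span K {SymmetricAlgebra.ι K W z} ⊔
        Submodule.span K {SymmetricAlgebra.ι K W (b 0), SymmetricAlgebra.ι K W (b 1)} := by
    rintro _ ⟨w, rfl⟩
    obtain ⟨r, s, hrs⟩ := Submodule.mem_span_pair.1 (hb (w - a l w • z) (by simp [hz]))
    rw [← sub_add_cancel w (a l w • z), ← hrs, add_comm]
    refine Submodule.mem_sup.2 ⟨_, Submodule.mem_span_singleton.2 ⟨a l w, rfl⟩, _,
      Submodule.mem_span_pair.2 ⟨r, s, rfl⟩, by simp⟩
  rw [pow_two, Apolarity.contract_mul, Apolarity.contract_ι, Apolarity.contract_ι] at hlf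
  obtain ⟨C, hC, G, hG, rfl⟩ := Apolarity.exists_eq_mul_add_of_derivation_sq_eq_zero
    (Apolarity.derivationOf (a l)) hM (by rw [Apolarity.derivationOf_ι, hz, map_one])
    (pow_le_pow_left' hrange 4 hf) hlf
  exact (Apolarity.isSumOfFourthPowers_seven hC hG).waringRank_le
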